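/- Let $k\ge 0$. A $k$-graph is a countable category $\Lambda$ with a functor $d:\Lambda\to\mathbb N^k$ (the degree) such that, whenever $d(\lambda)=m+n$, there are unique $\mu,\nu\in\Lambda$ with $d(\mu)=m$, $d(\nu)=n$ and $\lambda=\mu\nu$. Morphisms are called paths, $r(\lambda)$ and $s(\lambda)$ denote the codomain (range) and the domain (source) of $\lambda$, $\Lambda^0$ is the set of objects (vertices), identified with the paths of degree $0$, $\Lambda^n=d^{-1}(n)$, $v\Lambda^n=\{\lambda\in\Lambda^n: r(\lambda)=v\}$, and $\Lambda^{\ne 0}$ is the set of paths of nonzero degree. $\Lambda$ is row-finite if every $v\Lambda^n$ is finite, and has no sources if every $v\Lambda^n$ is nonempty. Isomorphisms of $k$-graphs are degree-preserving isomorphisms of categories; $\mathbb N^k$ is regarded as the $k$-graph with one vertex, with composition given by addition and with the identity map as degree. For a row-finite $k$-graph $\Lambda$ with no sources and a commutative ring $R$ with $1\neq 0$, the Kumjian-Pask algebra $\mathrm{KP}_R(\Lambda)$ is the universal (not necessarily unital) $R$-algebra generated by elements $p_v$ $(v\in\Lambda^0)$ and $s_\lambda,s_{\lambda^*}$ $(\lambda\in\Lambda^{\neq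 0})$ subject to: (KP1) the $p_v$ are mutually orthogonal idempotents; (KP2) for $\lambda,\mu\in\Lambda^{\neq0}$ with $r(\mu)=s(\lambda)$: $s_\lambda s_\mu=s_{\lambda\mu}$, $s_{\mu^*}s_{\lambda^*}=s_{(\lambda\mu)^*}$, $p_{r(\lambda)}s_\lambda=s_\lambda=s_\lambda p_{s(\lambda)}$ and $p_{s(\lambda)}s_{\lambda^*}=s_{\lambda^*}=s_{\lambda^*}p_{r(\lambda)}$; (KP3) $s_{\lambda^*}s_\mu=\delta_{\lambda,\mu}\,p_{s(\lambda)}$ for $\lambda,\mu\in\Lambda^{\neq0}$ with $d(\lambda)=d(\mu)$; (KP4) $p_v=\sum_{\lambda\in v\Lambda^n}s_\lambda s_{\lambda^*}$ for $v\in\Lambda^0$ and $n\in\mathbb N^k\setminus\{0\}$. **Proposition.** Let $\Lambda$ be a row-finite $k$-graph with no sources and let $R$ be a commutative ring with $1\neq 0$. The following conditions are equivalent: 1. $\mathrm{KP}_R(\Lambda)$ is commutative; 2. $r(\lambda)=s(\lambda)$ for all $\lambda\in\Lambda$, and for every $n\in\mathbb N^k$ the restriction $r|_{\Lambda^n}$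 is injective; 3. $\Lambda\cong\bigsqcup_{v\in\Lambda^0}\mathbb N^k$ as $k$-graphs; 4. $\mathrm{KP}_R(\Lambda)\cong\bigoplus_{v\in\Lambda^0}R[x_1,x_1^{-1},\dots,x_k,x_k^{-1}]$ as (not necessarily unital) $R$-algebras. -/

import Mathlib

open CategoryTheory

universe u v w z

set_option linter.checkUnivs false in
/-- A `k`-graph (higher-rank graph): a countable small category with a degree functor to `ℕ^k`
satisfying the unique factorization property.

A path `f : a ⟶ b` has source `a` and range `b`; the product written `μν` (apply `ν` first, so that
`s(μ) = r(ν)`) is `ν ≫ μ`. The vertices are the objects. -/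
structure KGraph (k : ℕ) where
  /-- the vertices -/
  Obj : Type u
  [cat : Category.{v} Obj]
  /-- there are countably many paths (hence countably many vertices) -/
  countable_path : Countable (Arrow Obj)
  /-- the degree of a path -/
  deg : ∀ {a b : Obj}, (a ⟶ b) → (Fin k → ℕ)
  deg_id : ∀ a : Obj, deg (𝟙 a) = 0
  deg_comp : ∀ {a b c : Obj} (ν : a ⟶ b) (μ : b ⟶ c), deg (ν ≫ μ) = deg μ + deg ν
  /-- unique factorization: if `d(f) = m + n`, then `f = μν` for exactly one pair of paths `(μ, ν)`
  with `d(μ) = m` and `d(ν) = n` (the pair includes the middle vertex) -/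
  factor : ∀ {a b : Obj} (f : a ⟶ b) (m n : Fin k → ℕ), deg f = m + n →
    ∃! t : (Σ c : Obj, (c ⟶ b) × (a ⟶ c)),
      deg t.2.1 = m ∧ deg t.2.2 = n ∧ t.2.2 ≫ t.2.1 = f

namespace KGraph

attribute [instance] KGraph.cat KGraph.countable_path

variable {k : ℕ}

/-- The set of all paths of `Λ`, with arbitrary source and range. -/
abbrev Path (Λ : KGraph.{u, v} k) : Type (max u v) := Arrow Λ.Obj

/-- The range of a path. -/
abbrev r (Λ : KGraph.{u, v} k) (l : Λ.Path) : Λ.Obj := l.right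

/-- The source of a path. -/
abbrev s (Λ : KGraph.{u, v} k) (l : Λ.Path) : Λ.Obj := l.left

/-- The degree (shape) of a path. -/
abbrev d (Λ : KGraph.{u, v} k) (l : Λ.Path) : Fin k → ℕ := Λ.deg l.hom

/-- `vΛ^n`, the paths of shape `n` with range `x`. -/
abbrev PathsTo (Λ : KGraph.{u, v} k) (x : Λ.Obj) (n : Fin k → ℕ) : Type (max u v) :=
  {l : Λ.Path // Λ.r l = x ∧ Λ.d l = n}

/-- `Λ` is row-finite: every `vΛ^n` is finite. -/
class RowFinite (Λ : KGraph.{u, v} k) : Prop where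
  finite : ∀ (x : Λ.Obj) (n : Fin k → ℕ), Finite (Λ.PathsTo x n)

/-- `Λ` has no sources: every `vΛ^n` is nonempty. -/
def NoSources (Λ : KGraph.{u, v} k) : Prop :=
  ∀ (x : Λ.Obj) (n : Fin k → ℕ), Nonempty (Λ.PathsTo x n)

noncomputable instance (Λ : KGraph.{u, v} k) [Λ.RowFinite] (x : Λ.Obj) (n : Fin k → ℕ) :
    Fintype (Λ.PathsTo x n) :=
  haveI := RowFinite.finite x n
  Fintype.ofFinite _

/-- `Λ^{≠0}`, the paths of nonzero degree. -/
abbrev PosPath (Λ : KGraph.{u, v} k) : Type (max u v) := {l : Λ.Path // Λ.d l ≠ 0}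

/-- An element of `vΛ^n` with `n ≠ 0`, as an element of `Λ^{≠0}`. -/
abbrev toPos (Λ : KGraph.{u, v} k) {x : Λ.Obj} {n : Fin k → ℕ} (l : Λ.PathsTo x n) (hn : n ≠ 0) :
    Λ.PosPath :=
  ⟨l.1, fun h => hn (l.2.2.symm.trans h)⟩

/-- A morphism of nonzero degree, as an element of `Λ^{≠0}`. -/
abbrev pos (Λ : KGraph.{u, v} k) {a b : Λ.Obj} (f : a ⟶ b) (hf : Λ.deg f ≠ 0) : Λ.PosPath :=
  ⟨Arrow.mk f, hf⟩

/-- The product of two composable paths of nonzero degree, as an element of `Λ^{≠0}`. -/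
abbrev posMul (Λ : KGraph.{u, v} k) {a b c : Λ.Obj} (f : b ⟶ c) (g : a ⟶ b)
    (hf : Λ.deg f ≠ 0) : Λ.PosPath :=
  Λ.pos (g ≫ f) fun h => hf (by rw [deg_comp] at h; exact (add_eq_zero.1 h).1)

/-! ### Kumjian-Pask families and the Kumjian-Pask algebra -/

/-- `(P, S)` is a Kumjian-Pask `Λ`-family in `A`; the function `S` on paths and ghost paths of
nonzero degree is given as the pair `S`, `T`, where `T l` stands for `S_{l^*}`. -/
structure IsKPFamily (Λ : KGraph.{u, v} k) [Λ.RowFinite] {A : Type*} [NonUnitalRing A]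
    (P : Λ.Obj → A) (S T : Λ.PosPath → A) : Prop where
  idem : ∀ x, P x * P x = P x
  orth : ∀ x y, x ≠ y → P x * P y = 0
  mul : ∀ {a b c : Λ.Obj} (f : b ⟶ c) (g : a ⟶ b) (hf : Λ.deg f ≠ 0) (hg : Λ.deg g ≠ 0),
    S (Λ.pos f hf) * S (Λ.pos g hg) = S (Λ.posMul f g hf)
  ghost_mul : ∀ {a b c : Λ.Obj} (f : b ⟶ c) (g : a ⟶ b) (hf : Λ.deg f ≠ 0) (hg : Λ.deg g ≠ 0),
    T (Λ.pos g hg) * T (Λ.pos f hf) = T (Λ.posMul f g hf)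
  range_mul : ∀ l : Λ.PosPath, P (Λ.r l.1) * S l = S l
  mul_source : ∀ l : Λ.PosPath, S l * P (Λ.s l.1) = S l
  source_ghost : ∀ l : Λ.PosPath, P (Λ.s l.1) * T l = T l
  ghost_range : ∀ l : Λ.PosPath, T l * P (Λ.r l.1) = T l
  ghost_mul_self : ∀ l : Λ.PosPath, T l * S l = P (Λ.s l.1)
  ghost_mul_ne : ∀ l m : Λ.PosPath, Λ.d l.1 = Λ.d m.1 → l ≠ m → T l * S m = 0
  sum : ∀ (x : Λ.Obj) (n : Fin k → ℕ) (hn : n ≠ 0),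
    P x = ∑ l : Λ.PathsTo x n, S (Λ.toPos l hn) * T (Λ.toPos l hn)

/-- The generators of the Kumjian-Pask algebra: `p_v`, `s_λ` and `s_{λ^*}`. -/
inductive Gen (Λ : KGraph.{u, v} k) : Type (max u v)
  | vertex : Λ.Obj → Gen Λ
  | path : Λ.PosPath → Gen Λ
  | ghost : Λ.PosPath → Gen Λ

section Algebra

variable (R : Type w) [CommRing R]

/-- The free generator `p_v`. -/
abbrev fp (Λ : KGraph.{u, v} k) (x : Λ.Obj) : FreeAlgebra R Λ.Gen := FreeAlgebra.ι R (.vertex x)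

/-- The free generator `s_λ`. -/
abbrev fs (Λ : KGraph.{u, v} k) (l : Λ.PosPath) : FreeAlgebra R Λ.Gen := FreeAlgebra.ι R (.path l)

/-- The free generator `s_{λ^*}`. -/
abbrev ft (Λ : KGraph.{u, v} k) (l : Λ.PosPath) : FreeAlgebra R Λ.Gen := FreeAlgebra.ι R (.ghost l)

/-- The Kumjian-Pask relations on the free generators. -/
inductive KPRel (Λ : KGraph.{u, v} k) [Λ.RowFinite] :
    FreeAlgebra R Λ.Gen → FreeAlgebra R Λ.Gen → Prop
  | idem (x) : KPRel Λ (Λ.fp R x * Λ.fp R x) (Λ.fp R x)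
  | orth (x y) : x ≠ y → KPRel Λ (Λ.fp R x * Λ.fp R y) 0
  | mul {a b c : Λ.Obj} (f : b ⟶ c) (g : a ⟶ b) (hf : Λ.deg f ≠ 0) (hg : Λ.deg g ≠ 0) :
      KPRel Λ (Λ.fs R (Λ.pos f hf) * Λ.fs R (Λ.pos g hg)) (Λ.fs R (Λ.posMul f g hf))
  | ghost_mul {a b c : Λ.Obj} (f : b ⟶ c) (g : a ⟶ b) (hf : Λ.deg f ≠ 0) (hg : Λ.deg g ≠ 0) :
      KPRel Λ (Λ.ft R (Λ.pos g hg) * Λ.ft R (Λ.pos f hf)) (Λ.ft R (Λ.posMul f g hf))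
  | range_mul (l : Λ.PosPath) : KPRel Λ (Λ.fp R (Λ.r l.1) * Λ.fs R l) (Λ.fs R l)
  | mul_source (l : Λ.PosPath) : KPRel Λ (Λ.fs R l * Λ.fp R (Λ.s l.1)) (Λ.fs R l)
  | source_ghost (l : Λ.PosPath) : KPRel Λ (Λ.fp R (Λ.s l.1) * Λ.ft R l) (Λ.ft R l)
  | ghost_range (l : Λ.PosPath) : KPRel Λ (Λ.ft R l * Λ.fp R (Λ.r l.1)) (Λ.ft R l)
  | ghost_mul_self (l : Λ.PosPath) : KPRel Λ (Λ.ft R l * Λ.fs R l) (Λ.fp R (Λ.s l.1))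
  | ghost_mul_ne (l m : Λ.PosPath) : Λ.d l.1 = Λ.d m.1 → l ≠ m →
      KPRel Λ (Λ.ft R l * Λ.fs R m) 0
  | sum (x : Λ.Obj) (n : Fin k → ℕ) (hn : n ≠ 0) :
      KPRel Λ (Λ.fp R x)
        (∑ l : Λ.PathsTo x n, Λ.fs R (Λ.toPos l hn) * Λ.ft R (Λ.toPos l hn))

/-- The universal unital `R`-algebra generated by a Kumjian-Pask `Λ`-family. -/
abbrev UnitalKP (Λ : KGraph.{u, v} k) [Λ.RowFinite] : Type (max u v w) := RingQuot (Λ.KPRel R)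

/-- The image of a generator in `UnitalKP`. -/
noncomputable def gen (Λ : KGraph.{u, v} k) [Λ.RowFinite] (x : Λ.Gen) : Λ.UnitalKP R :=
  RingQuot.mkAlgHom R (Λ.KPRel R) (FreeAlgebra.ι R x)

/-- The Kumjian-Pask algebra `KP_R(Λ)`: the (in general non-unital) `R`-algebra generated by the
universal Kumjian-Pask `Λ`-family `(p, s)`, realized inside its unitization. Its universal property
among all non-unital `R`-algebras is `KP.existsUnique_lift` below. -/
abbrev KP (Λ : KGraph.{u, v} k) [Λ.RowFinite] : Type (max u v w) :=
  NonUnitalAlgebra.adjoin R (Set.range (Λ.gen R))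

namespace KP

variable (Λ : KGraph.{u, v} k) [Λ.RowFinite]

/-- A generator as an element of `KP_R(Λ)`. -/
noncomputable def gen (x : Λ.Gen) : Λ.KP R :=
  ⟨Λ.gen R x, NonUnitalAlgebra.subset_adjoin R ⟨x, rfl⟩⟩

/-- The generators form a Kumjian-Pask `Λ`-family in `KP_R(Λ)`. -/
theorem isKPFamily : Λ.IsKPFamily (fun x => gen R Λ (.vertex x)) (fun l => gen R Λ (.path l))
    (fun l => gen R Λ (.ghost l)) := by
  have key : ∀ {x y}, Λ.KPRel R x y →
      RingQuot.mkAlgHom R (Λ.KPRel R) x = RingQuot.mkAlgHom R (Λ.KPRel R) y :=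
    fun h => RingQuot.mkAlgHom_rel R h
  constructor
  · intro x; exact Subtype.ext (by simpa [gen, KGraph.gen] using key (.idem x))
  · intro x y h; exact Subtype.ext (by simpa [gen, KGraph.gen] using key (.orth x y h))
  · intro a b c f g hf hg
    exact Subtype.ext (by simpa [gen, KGraph.gen] using key (.mul f g hf hg))
  · intro a b c f g hf hg
    exact Subtype.ext (by simpa [gen, KGraph.gen] using key (.ghost_mul f g hf hg))
  · intro l; exact Subtype.ext (by simpa [gen, KGraph.gen] using key (.range_mul l))
  · intro l; exact Subtype.ext (by simpa [gen, KGraph.gen] using key (.mul_source l))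
  · intro l; exact Subtype.ext (by simpa [gen, KGraph.gen] using key (.source_ghost l))
  · intro l; exact Subtype.ext (by simpa [gen, KGraph.gen] using key (.ghost_range l))
  · intro l; exact Subtype.ext (by simpa [gen, KGraph.gen] using key (.ghost_mul_self l))
  · intro l m h h'
    exact Subtype.ext (by simpa [gen, KGraph.gen] using key (.ghost_mul_ne l m h h'))
  · intro x n hn
    exact Subtype.ext (by simpa [gen, KGraph.gen] using key (.sum x n hn))

variable {R Λ}

/-- The universal property of `KP_R(Λ)`. -/
theorem existsUnique_lift {A : Type*} [NonUnitalRing A] [Module R A] [IsScalarTower R A A]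
    [SMulCommClass R A A] {P : Λ.Obj → A} {S T : Λ.PosPath → A} (h : Λ.IsKPFamily P S T) :
    ∃! π : Λ.KP R →ₙₐ[R] A, (∀ x, π (gen R Λ (.vertex x)) = P x) ∧
      (∀ l, π (gen R Λ (.path l)) = S l) ∧ ∀ l, π (gen R Λ (.ghost l)) = T l := by
  let φ : Λ.Gen → A := fun x => match x with
    | .vertex x => P x
    | .path l => S l
    | .ghost l => T l
  let F : FreeAlgebra R Λ.Gen →ₐ[R] Unitization R A :=
    FreeAlgebra.lift R fun x => (φ x : Unitization R A)
  have hF : ∀ ⦃x y⦄, Λ.KPRel R x y → F x = F y := by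
    intro x y hxy
    have hs : ∀ {ι : Type (max u v)} [Fintype ι] (f : ι → A),
        ∑ i, (f i : Unitization R A) = ((∑ i, f i : A) : Unitization R A) := by
      intro ι _ f
      exact (map_sum (Unitization.inrNonUnitalAlgHom R A) f Finset.univ).symm
    cases hxy with
    | idem x => simp [F, φ, ← Unitization.inr_mul, h.idem]
    | orth x y hh => simp [F, φ, ← Unitization.inr_mul, h.orth x y hh]
    | mul f g hf hg => simp [F, φ, ← Unitization.inr_mul, h.mul f g hf hg]
    | ghost_mul f g hf hg => simp [F, φ, ← Unitization.inr_mul, h.ghost_mul f g hf hg]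
    | range_mul l => simpa [F, φ, ← Unitization.inr_mul] using h.range_mul l
    | mul_source l => simpa [F, φ, ← Unitization.inr_mul] using h.mul_source l
    | source_ghost l => simpa [F, φ, ← Unitization.inr_mul] using h.source_ghost l
    | ghost_range l => simpa [F, φ, ← Unitization.inr_mul] using h.ghost_range l
    | ghost_mul_self l => simpa [F, φ, ← Unitization.inr_mul] using h.ghost_mul_self l
    | ghost_mul_ne l m h1 h2 => simp [F, φ, ← Unitization.inr_mul, h.ghost_mul_ne l m h1 h2]
    | sum x n hn =>
      simp only [F, φ, map_sum, map_mul, FreeAlgebra.lift_ι_apply, ← Unitization.inr_mul, hs,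
        h.sum x n hn]
  let G : Λ.UnitalKP R →ₐ[R] Unitization R A := RingQuot.liftAlgHom R ⟨F, hF⟩
  have hG : ∀ x, G (Λ.gen R x) = (φ x : Unitization R A) := fun x => by
    simp [G, KGraph.gen, F]
  have hG' : ∀ a : Λ.KP R, ((G a.1).snd : Unitization R A) = G a.1 := by
    rintro ⟨a, ha⟩
    induction ha using NonUnitalAlgebra.adjoin_induction with
    | mem x hx => obtain ⟨y, rfl⟩ := hx; simp [hG]
    | add x y hx hy h1 h2 => simp only [map_add, Unitization.snd_add, Unitization.inr_add, h1, h2]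
    | zero => simp
    | mul x y hx hy h1 h2 =>
      simp only at h1 h2 ⊢
      rw [map_mul, ← h1, ← h2, ← Unitization.inr_mul, Unitization.snd_inr]
    | smul c x hx h1 => simp only [map_smul, Unitization.snd_smul, Unitization.inr_smul, h1]
  refine ⟨{ toFun := fun a => (G a.1).snd
            map_smul' := fun c a => by simp
            map_zero' := by simp
            map_add' := fun a b => by simp
            map_mul' := fun a b => by
              apply Unitization.inr_injective (R := R)
              rw [hG' (a * b), Unitization.inr_mul, hG' a, hG' b]
              simp }, ⟨?_, ?_, ?_⟩, ?_⟩
  · intro x; simp [gen, hG, φ]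
  · intro x; simp [gen, hG, φ]
  · intro x; simp [gen, hG, φ]
  · rintro π ⟨h1, h2, h3⟩
    ext ⟨a, ha⟩
    apply Unitization.inr_injective (R := R)
    change ((π ⟨a, ha⟩ : A) : Unitization R A) = ((G a).snd : Unitization R A)
    rw [hG' ⟨a, ha⟩]
    change _ = G a
    induction ha using NonUnitalAlgebra.adjoin_induction with
    | mem x hx =>
      obtain ⟨y, rfl⟩ := hx
      rw [hG]
      congr 1
      cases y with
      | vertex x => exact h1 x
      | path x => exact h2 x
      | ghost x => exact h3 x
    | add x y hx hy e1 e2 =>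
      rw [map_add, ← e1, ← e2, ← Unitization.inr_add, ← map_add]; rfl
    | zero => rw [map_zero, ← Unitization.inr_zero (R := R), ← map_zero π]; rfl
    | mul x y hx hy e1 e2 =>
      rw [map_mul, ← e1, ← e2, ← Unitization.inr_mul, ← map_mul]; rfl
    | smul c x hx e1 =>
      rw [map_smul, ← e1, ← Unitization.inr_smul, ← map_smul]; rfl

end KP

end Algebra

/-! ### The `k`-graph `ℕ^k`, disjoint unions and isomorphisms of `k`-graphs -/

/-- The category `ℕ^k` with one object, with composition given by addition and with the identity as
degree functor. -/
def natGraph (k : ℕ) : KGraph.{0, 0} k where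
  Obj := SingleObj (Multiplicative (Fin k → ℕ))
  countable_path := by
    have : Countable (Multiplicative (Fin k → ℕ)) :=
      inferInstanceAs (Countable (Fin k → ℕ))
    refine Function.Surjective.countable
      (f := fun n : Multiplicative (Fin k → ℕ) =>
        (Arrow.mk (show SingleObj.star _ ⟶ SingleObj.star _ from n) :
          Arrow (SingleObj (Multiplicative (Fin k → ℕ))))) ?_
    rintro ⟨⟨⟩, ⟨⟩, f⟩
    exact ⟨f, rfl⟩
  deg f := Multiplicative.toAdd (show Multiplicative (Fin k → ℕ) from f)
  deg_id _ := rfl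
  deg_comp _ _ := rfl
  factor := by
    rintro ⟨⟩ ⟨⟩ f m n h
    refine ⟨⟨SingleObj.star _, Multiplicative.ofAdd m, Multiplicative.ofAdd n⟩,
      ⟨rfl, rfl, h.symm⟩, ?_⟩
    rintro ⟨⟨⟩, μ, ν⟩ ⟨h1, h2, -⟩
    dsimp only at h1 h2
    subst h1 h2
    rfl

/-- The degree of a path in a disjoint union of `k`-graphs: its degree in the component it is in. -/
def unionDeg {ι : Type w} (Γ : ι → KGraph.{u, v} k) :
    ∀ {a b : Σ i, (Γ i).Obj}, Sigma.SigmaHom a b → (Fin k → ℕ)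
  | _, _, .mk f => (Γ _).deg f

/-- The disjoint union of a countable family of `k`-graphs. -/
def disjointUnion {ι : Type w} [Countable ι] (Γ : ι → KGraph.{u, v} k) :
    KGraph.{max w u, max w u v} k where
  Obj := Σ i, (Γ i).Obj
  countable_path := by
    refine Function.Surjective.countable (f := fun l : (Σ i, (Γ i).Path) =>
      (Arrow.mk (Sigma.SigmaHom.mk l.2.hom : (⟨l.1, l.2.left⟩ : Σ i, (Γ i).Obj) ⟶
        ⟨l.1, l.2.right⟩) : Arrow (Σ i, (Γ i).Obj))) ?_
    rintro ⟨_, _, ⟨f⟩⟩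
    exact ⟨⟨_, Arrow.mk f⟩, rfl⟩
  deg f := unionDeg Γ f
  deg_id := fun ⟨i, a⟩ => (Γ i).deg_id a
  deg_comp := by
    rintro _ _ _ ⟨ν⟩ ⟨μ⟩
    exact (Γ _).deg_comp ν μ
  factor := by
    rintro _ _ ⟨f⟩ m n h
    rename_i i a b
    obtain ⟨⟨c, μ, ν⟩, ⟨h1, h2, h3⟩, hu⟩ := (Γ i).factor f m n h
    refine ⟨⟨⟨i, c⟩, Sigma.SigmaHom.mk μ, Sigma.SigmaHom.mk ν⟩, ⟨h1, h2, congrArg Sigma.SigmaHom.mk h3⟩, ?_⟩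
    rintro ⟨_, ⟨μ'⟩, ⟨ν'⟩⟩ ⟨h1', h2', h3'⟩
    have := hu ⟨_, μ', ν'⟩ ⟨h1', h2', by injection h3'⟩
    cases this
    rfl

/-- An isomorphism of `k`-graphs: mutually inverse functors that preserve the degree. -/
structure Iso {k : ℕ} (Λ : KGraph.{u, v} k) (Γ : KGraph.{w, z} k) where
  toFunctor : Λ.Obj ⥤ Γ.Obj
  invFunctor : Γ.Obj ⥤ Λ.Obj
  left_inv : toFunctor ⋙ invFunctor = 𝟭 Λ.Obj
  right_inv : invFunctor ⋙ toFunctor = 𝟭 Γ.Obj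
  deg_map : ∀ {a b : Λ.Obj} (f : a ⟶ b), Γ.deg (toFunctor.map f) = Λ.deg f

instance (Λ : KGraph.{u, v} k) : Countable Λ.Obj :=
  Function.Injective.countable (f := fun a : Λ.Obj => Arrow.mk (𝟙 a)) fun _ _ h =>
    congrArg (fun l : Arrow Λ.Obj => l.left) h

end KGraph

/-- The ring of Laurent polynomials `R[x_1, x_1⁻¹, …, x_k, x_k⁻¹]` in `k` commuting
indeterminates (`k = 1` is Mathlib's `LaurentPolynomial`). -/
abbrev LaurentRing (R : Type w) [CommRing R] (k : ℕ) : Type w := AddMonoidAlgebra R (Fin k → ℤ)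

/-! Conditions 2 and 3 are tied by pure category theory; the algebra enters in 1 → 2 → 4 → 1, where
4 → 1 is immediate because an injective homomorphism pulls commutativity back from the Laurent
rings.

For 1 → 2 the essential input is that no vertex idempotent $p_v$ is zero (`KP.gen_vertex_ne_zero`).
This needs a representation. On functions on finite paths let $s_\mu$ shift along $b \mapsto \mu b$
and $s_{\mu^*}$ shift back. Everything holds except (KP4), since $\sum_{\lambda\in v\Lambda^n}
s_\lambda s_{\lambda^*}$ ignores paths of degree not above $n$. Dividing by the functions that
vanish on all paths of large degree repairs (KP4), and without sources the constant function 1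
survives under $p_v$. These germs replace the infinite path space. Given $p_v \ne 0$, commutativity
makes $s_\lambda = p_{r(\lambda)} s_\lambda p_{s(\lambda)}$ vanish if $r(\lambda)\ne s(\lambda)$,
and makes $p_v = s_{\lambda^*}s_\lambda s_{\mu^*}s_\mu$ vanish if $\lambda\neq\mu$ are loops at $v$
of equal degree.

For 2 → 4, each vertex carries exactly one loop of each degree, so (KP3) and (KP4) say that $n
\mapsto s_n$ maps $\mathbb N^k$ into the units of the corner at $p_v$. It extends to $\mathbb Z^k$
by $x^n \mapsto s_{n^+}s_{n^-}^*$, which yields an inverse to the map given by the universal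
property. -/

namespace KGraph

/-! ### Composition of paths as a relation -/

section Paths

variable {k : ℕ} {Λ : KGraph.{u, v} k}

/-- `IsComp μ ν ρ` says that the paths `μ` and `ν` are composable with product `ρ = μν`. -/
def IsComp (μ ν ρ : Λ.Path) : Prop :=
  ∃ h : ν.right = μ.left, ρ = Arrow.mk (ν.hom ≫ eqToHom h ≫ μ.hom)

theorem isComp_mk {a b c : Λ.Obj} (f : b ⟶ c) (g : a ⟶ b) :
    IsComp (Λ := Λ) (Arrow.mk f) (Arrow.mk g) (Arrow.mk (g ≫ f)) :=
  ⟨rfl, by simp⟩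

/-- Substituting the vertex equality removes the `eqToHom`, so that relational facts reduce to facts
about genuine morphisms. -/
theorem IsComp.exists_eq_mk {μ ν ρ : Λ.Path} (h : IsComp μ ν ρ) :
    ∃ (a b c : Λ.Obj) (f : b ⟶ c) (g : a ⟶ b),
      μ = Arrow.mk f ∧ ν = Arrow.mk g ∧ ρ = Arrow.mk (g ≫ f) := by
  obtain ⟨b, c, f⟩ := μ
  obtain ⟨a, b', g⟩ := ν
  obtain ⟨h, rfl⟩ := h
  obtain rfl : b' = b := h
  exact ⟨_, _, _, f, g, rfl, rfl, congrArg Arrow.mk (congrArg (g ≫ ·) (Category.id_comp f))⟩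

theorem IsComp.deg_eq {μ ν ρ : Λ.Path} (h : IsComp μ ν ρ) : Λ.d ρ = Λ.d μ + Λ.d ν := by
  obtain ⟨a, b, c, f, g, rfl, rfl, rfl⟩ := h.exists_eq_mk
  exact Λ.deg_comp g f

theorem IsComp.range_eq {μ ν ρ : Λ.Path} (h : IsComp μ ν ρ) : Λ.r ρ = Λ.r μ := by
  obtain ⟨a, b, c, f, g, rfl, rfl, rfl⟩ := h.exists_eq_mk
  rfl

theorem IsComp.range_right {μ ν ρ : Λ.Path} (h : IsComp μ ν ρ) : Λ.r ν = Λ.s μ := h.1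

theorem IsComp.unique {μ ν ρ ρ' : Λ.Path} (h : IsComp μ ν ρ) (h' : IsComp μ ν ρ') : ρ = ρ' := by
  obtain ⟨_, rfl⟩ := h
  obtain ⟨_, rfl⟩ := h'
  rfl

theorem exists_isComp {μ ν : Λ.Path} (h : Λ.r ν = Λ.s μ) : ∃ ρ, IsComp μ ν ρ := ⟨_, h, rfl⟩

/-- Uniqueness of factorization; the degrees of the second factors agree by cancellation in $\mathbb
N^k$. -/
theorem IsComp.eq_of_deg_eq {μ ν μ' ν' ρ : Λ.Path} (h : IsComp μ ν ρ) (h' : IsComp μ' ν' ρ)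
    (hd : Λ.d μ = Λ.d μ') : μ = μ' ∧ ν = ν' := by
  have hd' : Λ.d ν = Λ.d ν' := by
    have := h.deg_eq.symm.trans h'.deg_eq
    rw [hd] at this
    exact add_left_cancel this
  obtain ⟨a, b, c, f, g, rfl, rfl, rfl⟩ := h.exists_eq_mk
  obtain ⟨a', b', c', f', g', rfl, rfl, h3⟩ := h'.exists_eq_mk
  obtain rfl : a = a' := congrArg (fun l : Arrow Λ.Obj => l.left) h3
  obtain rfl : c = c' := congrArg (fun l : Arrow Λ.Obj => l.right) h3
  have h4 := (Λ.factor (g ≫ f) (Λ.deg f) (Λ.deg g) (Λ.deg_comp g f)).unique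
    (y₁ := ⟨b, f, g⟩) (y₂ := ⟨b', f', g'⟩) ⟨rfl, rfl, rfl⟩
    ⟨hd.symm, hd'.symm, (Arrow.mk_injective _ _ h3).symm⟩
  cases h4
  exact ⟨rfl, rfl⟩

theorem IsComp.left_cancel {μ ν ν' ρ : Λ.Path} (h : IsComp μ ν ρ) (h' : IsComp μ ν' ρ) : ν = ν' :=
  (h.eq_of_deg_eq h' rfl).2

theorem exists_isComp_of_le {ρ : Λ.Path} {n : Fin k → ℕ} (h : n ≤ Λ.d ρ) :
    ∃ μ ν, IsComp μ ν ρ ∧ Λ.d μ = n := by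
  obtain ⟨⟨c, f, g⟩, ⟨h1, -, h3⟩, -⟩ :=
    Λ.factor ρ.hom n (Λ.d ρ - n) (add_tsub_cancel_of_le h).symm
  refine ⟨Arrow.mk f, Arrow.mk g, ?_, h1⟩
  have := isComp_mk f g
  rw [h3] at this
  exact this

/-- Associativity, phrased as a composite of relations: this is the form in which it gives both
product rules of (KP2) on germs. -/
theorem IsComp.assoc_iff {μ ν ρ : Λ.Path} (h : IsComp μ ν ρ) (κ τ : Λ.Path) :
    IsComp ρ κ τ ↔ ∃ σ, IsComp ν κ σ ∧ IsComp μ σ τ := by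
  obtain ⟨a, b, c, f, g, rfl, rfl, rfl⟩ := h.exists_eq_mk
  obtain ⟨x, y, e⟩ := κ
  constructor
  · rintro ⟨h, rfl⟩
    dsimp at h e
    subst h
    exact ⟨_, ⟨rfl, rfl⟩, ⟨rfl, by simp⟩⟩
  · rintro ⟨_, ⟨h, rfl⟩, ⟨h', rfl⟩⟩
    dsimp at h e
    subst h
    exact ⟨rfl, by simp⟩

/-- A path of degree zero is an identity. -/
theorem eq_id_of_deg_eq_zero {l : Λ.Path} (h : Λ.d l = 0) : l = Arrow.mk (𝟙 (Λ.r l)) := by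
  obtain ⟨a, b, f⟩ := l
  dsimp at f
  -- The path factors both as itself times an identity and as an identity times itself; both left
  -- factors have degree zero, hence coincide.
  have h1 : IsComp (Λ := Λ) (Arrow.mk f) (Arrow.mk (𝟙 a)) (Arrow.mk (𝟙 a ≫ f)) := isComp_mk _ _
  have h2 : IsComp (Λ := Λ) (Arrow.mk (𝟙 b)) (Arrow.mk f) (Arrow.mk (f ≫ 𝟙 b)) := isComp_mk _ _
  rw [Category.id_comp] at h1
  rw [Category.comp_id] at h2
  exact (h1.eq_of_deg_eq h2 (h.trans (Λ.deg_id b).symm)).1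

end Paths

/-! ### Pulling functions back along partial maps -/

section Pullback

open Classical in
/-- The pullback of functions along the partial map with graph `Q`, extended by zero. -/
noncomputable def pullback (R : Type w) [CommRing R] {α : Type z} (Q : α → α → Prop) :
    (α → R) →ₗ[R] (α → R) where
  toFun f a := if h : ∃ b, Q a b then f h.choose else 0
  map_add' f g := by
    ext a
    by_cases h : ∃ b, Q a b <;> simp [h]
  map_smul' c f := by
    ext a
    by_cases h : ∃ b, Q a b <;> simp [h]

variable {R : Type w} [CommRing R] {α : Type z} {Q Q' Q'' : α → α → Prop}

theorem pullback_apply_of (hQ : Relator.RightUnique Q) {a b : α} (h : Q a b) (f : α → R) :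
    pullback R Q f a = f b := by
  have h' : ∃ b, Q a b := ⟨b, h⟩
  have : pullback R Q f a = f h'.choose := dif_pos h'
  rw [this, hQ h'.choose_spec h]

theorem pullback_apply_of_not {a : α} (h : ∀ b, ¬ Q a b) (f : α → R) :
    pullback R Q f a = 0 :=
  dif_neg fun ⟨b, hb⟩ => h b hb

/-- Pullback turns composition of partial maps into composition of operators. Single-valuedness of
`Q` rules out a second route through another intermediate point. -/
theorem pullback_pullback (hQ : Relator.RightUnique Q) (hQ' : Relator.RightUnique Q')
    (hQ'' : ∀ a c, Q'' a c ↔ ∃ b, Q a b ∧ Q' b c) (f : α → R) :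
    pullback R Q (pullback R Q' f) = pullback R Q'' f := by
  have hu : Relator.RightUnique Q'' := by
    intro a c c' h h'
    obtain ⟨b, hb, hc⟩ := (hQ'' _ _).1 h
    obtain ⟨b', hb', hc'⟩ := (hQ'' _ _).1 h'
    obtain rfl := hQ hb hb'
    exact hQ' hc hc'
  ext a
  by_cases h : ∃ b, Q a b
  · obtain ⟨b, hb⟩ := h
    rw [pullback_apply_of hQ hb]
    by_cases h' : ∃ c, Q' b c
    · obtain ⟨c, hc⟩ := h'
      rw [pullback_apply_of hQ' hc, pullback_apply_of hu ((hQ'' _ _).2 ⟨b, hb, hc⟩)]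
    · rw [pullback_apply_of_not (fun c hc => h' ⟨c, hc⟩), pullback_apply_of_not]
      intro c hc
      obtain ⟨b', hb', hc'⟩ := (hQ'' _ _).1 hc
      obtain rfl := hQ hb hb'
      exact h' ⟨c, hc'⟩
  · rw [pullback_apply_of_not (fun c hc => h ⟨c, hc⟩), pullback_apply_of_not]
    intro c hc
    obtain ⟨b', hb', -⟩ := (hQ'' _ _).1 hc
    exact h ⟨b', hb'⟩

end Pullback

/-! ### A representation on germs at infinity of functions on paths -/

section Germs

variable {k : ℕ} (Λ : KGraph.{u, v} k) (R : Type w) [CommRing R]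

/-- The functions on paths that vanish on all paths of sufficiently large degree. -/
def vanishing : Submodule R (Λ.Path → R) where
  carrier := {f | ∃ n, ∀ a, n ≤ Λ.d a → f a = 0}
  add_mem' := by
    rintro f g ⟨m, hm⟩ ⟨n, hn⟩
    exact ⟨m ⊔ n, fun a ha => by
      simp [hm a (le_sup_left.trans ha), hn a (le_sup_right.trans ha)]⟩
  zero_mem' := ⟨0, fun _ _ => rfl⟩
  smul_mem' := by
    rintro c f ⟨m, hm⟩
    exact ⟨m, fun a ha => by simp [hm a ha]⟩

/-- Germs at infinity of functions on paths. -/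
abbrev Germs : Type (max u v w) := (Λ.Path → R) ⧸ Λ.vanishing R

variable {Λ}

/-- The partial map with graph `Q` has images of large degree at paths of large degree. -/
def IsProper (Q : Λ.Path → Λ.Path → Prop) : Prop := ∃ c, ∀ a b, Q a b → Λ.d a ≤ Λ.d b + c

theorem IsProper.le_comap {Q : Λ.Path → Λ.Path → Prop} (h : IsProper Q)
    (hQ : Relator.RightUnique Q) :
    Λ.vanishing R ≤ (Λ.vanishing R).comap (pullback R Q) := by
  rintro f ⟨n, hn⟩
  obtain ⟨c, hc⟩ := h
  -- The shift by `c` pays for the degree that the partial map may lose.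
  refine ⟨n + c, fun a ha => ?_⟩
  by_cases h' : ∃ b, Q a b
  · obtain ⟨b, hb⟩ := h'
    rw [pullback_apply_of hQ hb]
    exact hn b (le_of_add_le_add_right (ha.trans (hc a b hb)))
  · exact pullback_apply_of_not (fun b hb => h' ⟨b, hb⟩) f

/-- The operator on germs induced by a proper partial map. -/
noncomputable def germOp (Q : Λ.Path → Λ.Path → Prop) (h : IsProper Q)
    (hQ : Relator.RightUnique Q) : Module.End R (Λ.Germs R) :=
  Submodule.mapQ _ _ (pullback R Q) (h.le_comap R hQ)

variable {R} {Q Q' Q'' : Λ.Path → Λ.Path → Prop}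

theorem germOp_mk (h : IsProper Q) (hQ : Relator.RightUnique Q) (f : Λ.Path → R) :
    germOp R Q h hQ (Submodule.Quotient.mk f) = Submodule.Quotient.mk (pullback R Q f) := rfl

theorem germOp_mul (h : IsProper Q) (hQ : Relator.RightUnique Q) (h' : IsProper Q')
    (hQ' : Relator.RightUnique Q') (h'' : IsProper Q'') (hQ'' : Relator.RightUnique Q'')
    (H : ∀ a c, Q'' a c ↔ ∃ b, Q a b ∧ Q' b c) :
    germOp R Q h hQ * germOp R Q' h' hQ' = germOp R Q'' h'' hQ'' := by
  refine LinearMap.ext fun x => ?_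
  obtain ⟨f, rfl⟩ := Submodule.Quotient.mk_surjective _ x
  rw [Module.End.mul_apply, germOp_mk, germOp_mk, germOp_mk, pullback_pullback hQ hQ' H]

theorem germOp_mul_eq_zero (h : IsProper Q) (hQ : Relator.RightUnique Q) (h' : IsProper Q')
    (hQ' : Relator.RightUnique Q') (H : ∀ a b c, Q a b → ¬ Q' b c) :
    germOp R Q h hQ * germOp R Q' h' hQ' = 0 := by
  refine LinearMap.ext fun x => ?_
  obtain ⟨f, rfl⟩ := Submodule.Quotient.mk_surjective _ x
  rw [Module.End.mul_apply, germOp_mk, germOp_mk,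
    -- The composite partial map is nowhere defined.
    pullback_pullback hQ hQ' (Q'' := fun _ _ => False)
      (fun a c => ⟨False.elim, fun ⟨b, h1, h2⟩ => H a b c h1 h2⟩)]
  have : pullback R (fun _ _ : Λ.Path => False) f = 0 := by
    ext a
    exact pullback_apply_of_not (fun _ => id) f
  rw [this]
  rfl

/-- The graph of the identity on the paths with range `x`. -/
def VertexRel (x : Λ.Obj) (a b : Λ.Path) : Prop := a = b ∧ Λ.r b = x

/-- The graph of the removal of the initial segment `μ`. -/
def RemoveRel (μ a b : Λ.Path) : Prop := IsComp μ b a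

/-- The graph of `a ↦ μa`. -/
def PrependRel (μ a b : Λ.Path) : Prop := IsComp μ a b

theorem rightUnique_vertexRel (x : Λ.Obj) : Relator.RightUnique (VertexRel x) := by
  rintro a b c ⟨rfl, -⟩ ⟨rfl, -⟩
  rfl

theorem rightUnique_removeRel (μ : Λ.Path) : Relator.RightUnique (RemoveRel μ) :=
  fun _ _ _ h h' => h.left_cancel h'

theorem rightUnique_prependRel (μ : Λ.Path) : Relator.RightUnique (PrependRel μ) :=
  fun _ _ _ h h' => IsComp.unique h h'

theorem isProper_vertexRel (x : Λ.Obj) : IsProper (VertexRel x) :=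
  ⟨0, by rintro a b ⟨rfl, -⟩; simp⟩

theorem isProper_removeRel (μ : Λ.Path) : IsProper (RemoveRel μ) :=
  ⟨Λ.d μ, fun _ _ h => by rw [IsComp.deg_eq h, add_comm]⟩

theorem isProper_prependRel (μ : Λ.Path) : IsProper (PrependRel μ) :=
  ⟨0, fun _ _ h => by rw [IsComp.deg_eq h]; simp⟩

variable (R)

/-- The operator representing `p_x` on germs. -/
noncomputable def germVertex (x : Λ.Obj) : Module.End R (Λ.Germs R) :=
  germOp R (VertexRel x) (isProper_vertexRel x) (rightUnique_vertexRel x)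

/-- The operator representing `s_μ` on germs. -/
noncomputable def germPath (μ : Λ.Path) : Module.End R (Λ.Germs R) :=
  germOp R (RemoveRel μ) (isProper_removeRel μ) (rightUnique_removeRel μ)

/-- The operator representing `s_{μ^*}` on germs. -/
noncomputable def germGhost (μ : Λ.Path) : Module.End R (Λ.Germs R) :=
  germOp R (PrependRel μ) (isProper_prependRel μ) (rightUnique_prependRel μ)

/-- The one relation that requires germs: each summand restricts a function to the paths beginning
with the given segment, and only paths of degree at least `n` are certain to have an initial segment
of degree `n`. -/
theorem germVertex_eq_sum [Λ.RowFinite] (x : Λ.Obj) (n : Fin k → ℕ) :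
    germVertex R x = ∑ l : Λ.PathsTo x n, germPath R l.1 * germGhost R l.1 := by
  refine LinearMap.ext fun g => ?_
  obtain ⟨f, rfl⟩ := Submodule.Quotient.mk_surjective _ g
  rw [LinearMap.sum_apply]
  have : ∀ l : Λ.PathsTo x n, (germPath R l.1 * germGhost R l.1) (Submodule.Quotient.mk f) =
      (Λ.vanishing R).mkQ (pullback R (RemoveRel l.1) (pullback R (PrependRel l.1) f)) :=
    fun l => rfl
  simp_rw [this]
  rw [← map_sum]
  refine (Submodule.Quotient.eq _).2 ⟨n, fun a ha => ?_⟩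
  rw [Pi.sub_apply, Finset.sum_apply, sub_eq_zero]
  obtain ⟨μ, ν, hμ, hd⟩ := exists_isComp_of_le ha
  -- By unique factorization `μ` is the only initial segment of `a` of degree `n`, so at most one
  -- summand contributes at `a`.
  have hval : ∀ l : Λ.PathsTo x n, l.1 ≠ μ →
      pullback R (RemoveRel l.1) (pullback R (PrependRel l.1) f) a = 0 := fun l hl =>
    pullback_apply_of_not
      (fun b (hb : RemoveRel l.1 a b) => hl (IsComp.eq_of_deg_eq hb hμ (l.2.2.trans hd.symm)).1) (pullback R (PrependRel l.1) f)
  by_cases hx : Λ.r a = x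
  · rw [pullback_apply_of (rightUnique_vertexRel x) ⟨rfl, hx⟩,
      Finset.sum_eq_single (⟨μ, hμ.range_eq.symm.trans hx, hd⟩ : Λ.PathsTo x n)
        (fun l _ hl => hval l fun h => hl (Subtype.ext h)) (by simp)]
    rw [pullback_apply_of (rightUnique_removeRel μ) hμ,
      pullback_apply_of (rightUnique_prependRel μ) hμ]
  · rw [pullback_apply_of_not, Finset.sum_eq_zero]
    · intro l _
      refine hval l ?_
      rintro rfl
      exact hx (hμ.range_eq.trans l.2.1)
    · rintro b ⟨rfl, h⟩
      exact hx h

/-- Apart from (KP4), every relation is an identity between composites of partial maps on paths,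
already valid before passing to germs. -/
theorem isKPFamily_germ [Λ.RowFinite] :
    Λ.IsKPFamily (germVertex (Λ := Λ) R) (fun l => germPath R l.1) (fun l => germGhost R l.1) where
  idem x := germOp_mul _ _ _ _ _ _ fun a c => by
    constructor
    · rintro ⟨rfl, h⟩
      exact ⟨a, ⟨rfl, h⟩, rfl, h⟩
    · rintro ⟨b, ⟨rfl, h⟩, rfl, -⟩
      exact ⟨rfl, h⟩
  orth x y hxy := germOp_mul_eq_zero _ _ _ _ <| by
    rintro a b c ⟨rfl, h⟩ ⟨rfl, h'⟩
    exact hxy (h.symm.trans h')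
  mul f g hf hg := germOp_mul _ _ _ _ _ _ fun a c => by
    refine ((isComp_mk f g).assoc_iff c a).trans ⟨?_, ?_⟩ <;>
    · rintro ⟨b, h1, h2⟩
      exact ⟨b, h2, h1⟩
  ghost_mul f g hf hg := germOp_mul _ _ _ _ _ _ fun a c => (isComp_mk f g).assoc_iff a c
  range_mul l := germOp_mul _ _ _ _ _ _ fun a c => by
    constructor
    · intro h
      exact ⟨a, ⟨rfl, IsComp.range_eq h⟩, h⟩
    · rintro ⟨b, ⟨rfl, -⟩, h⟩
      exact h
  mul_source l := germOp_mul _ _ _ _ _ _ fun a c => by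
    constructor
    · intro h
      exact ⟨c, h, rfl, IsComp.range_right h⟩
    · rintro ⟨b, h, rfl, -⟩
      exact h
  source_ghost l := germOp_mul _ _ _ _ _ _ fun a c => by
    constructor
    · intro h
      exact ⟨a, ⟨rfl, IsComp.range_right h⟩, h⟩
    · rintro ⟨b, ⟨rfl, -⟩, h⟩
      exact h
  ghost_range l := germOp_mul _ _ _ _ _ _ fun a c => by
    constructor
    · intro h
      exact ⟨c, h, rfl, IsComp.range_eq h⟩
    · rintro ⟨b, h, rfl, -⟩
      exact h
  ghost_mul_self l := germOp_mul _ _ _ _ _ _ fun a c => by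
    constructor
    · rintro ⟨rfl, h⟩
      obtain ⟨b, hb⟩ := exists_isComp h
      exact ⟨b, hb, hb⟩
    · rintro ⟨b, h, h'⟩
      exact ⟨IsComp.left_cancel h h', IsComp.range_right h'⟩
  ghost_mul_ne l m hd hlm := germOp_mul_eq_zero _ _ _ _ fun a b c h h' =>
    hlm (Subtype.ext (IsComp.eq_of_deg_eq h h' hd).1)
  sum x n hn := germVertex_eq_sum R x n

theorem germVertex_ne_zero [Nontrivial R] (hΛ : Λ.NoSources) (x : Λ.Obj) :
    germVertex R x ≠ 0 := by
  intro h
  have h1 : germVertex R x (Submodule.Quotient.mk 1) = 0 := by rw [h]; rfl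
  obtain ⟨n, hn⟩ := (Submodule.Quotient.mk_eq_zero _).1 h1
  -- A path at `x` of degree exactly `n` lies in the range where the restricted constant function 1
  -- would have to vanish.
  obtain ⟨l, hl, hd⟩ := hΛ x n
  have := hn l hd.ge
  rw [pullback_apply_of (rightUnique_vertexRel x) ⟨rfl, hl⟩] at this
  exact one_ne_zero this

/-- The vertex idempotents of the Kumjian-Pask algebra are nonzero. -/
theorem KP.gen_vertex_ne_zero [Λ.RowFinite] [Nontrivial R] (hΛ : Λ.NoSources) (x : Λ.Obj) :
    KP.gen R Λ (.vertex x) ≠ 0 := by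
  intro h
  obtain ⟨π, ⟨hπ, -⟩, -⟩ := KP.existsUnique_lift (R := R) (isKPFamily_germ (Λ := Λ) R)
  apply germVertex_ne_zero R hΛ x
  rw [← hπ, h, map_zero]

end Germs

end KGraph

namespace KGraph

/-! ### Commutativity forces the graph to be a disjoint union of copies of `ℕ^k` -/

section Commutative

variable {k : ℕ} {Λ : KGraph.{u, v} k} [Λ.RowFinite] (R : Type w) [CommRing R] [Nontrivial R]

/-- Commuting the source idempotent past $s_\lambda$ puts it next to the orthogonal range
idempotent, so $s_\lambda=0$ and then $p_{s(\lambda)}=s_{\lambda^*}s_\lambda=0$. -/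
theorem range_eq_source_of_commutative (hΛ : Λ.NoSources) (h : ∀ a b : Λ.KP R, a * b = b * a)
    (l : Λ.Path) : Λ.r l = Λ.s l := by
  by_cases hl : Λ.d l = 0
  · have := congrArg Λ.s (eq_id_of_deg_eq_zero hl)
    exact this.symm
  · by_contra hne
    have F := KP.isKPFamily R Λ
    let L : Λ.PosPath := ⟨l, hl⟩
    have h0 : KP.gen R Λ (.path L) = 0 := by
      rw [← F.range_mul L, ← F.mul_source L, h (KP.gen R Λ (.path L)), ← mul_assoc,
        F.orth _ _ hne, zero_mul]
    apply KP.gen_vertex_ne_zero R hΛ (Λ.s l)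
    rw [← F.ghost_mul_self L, h0, mul_zero]

theorem injOn_range_of_commutative (hΛ : Λ.NoSources) (h : ∀ a b : Λ.KP R, a * b = b * a)
    (n : Fin k → ℕ) : Set.InjOn Λ.r {l : Λ.Path | Λ.d l = n} := by
  intro l hl m hm hlm
  rw [Set.mem_ofPred_eq] at hl hm
  by_cases hn : n = 0
  · rw [eq_id_of_deg_eq_zero (hl.trans hn), eq_id_of_deg_eq_zero (hm.trans hn), hlm]
  · by_contra hne
    have F := KP.isKPFamily R Λ
    let L : Λ.PosPath := ⟨l, fun h => hn (hl.symm.trans h)⟩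
    let M : Λ.PosPath := ⟨m, fun h => hn (hm.symm.trans h)⟩
    have hs : Λ.s l = Λ.s m := by
      rw [← range_eq_source_of_commutative R hΛ h, ← range_eq_source_of_commutative R hΛ h, hlm]
    apply KP.gen_vertex_ne_zero R hΛ (Λ.s l)
    have h1 := F.ghost_mul_self L
    have h2 : _ = KP.gen R Λ (.vertex (Λ.s l)) := (F.ghost_mul_self M).trans (by rw [hs])
    rw [← F.idem]
    nth_rw 1 [← h1]
    -- The factors of $s_{l^*}s_l s_{m^*}s_m$ are permuted to $s_{l^*}s_m s_{m^*}s_l$, whose first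
    -- two factors multiply to zero by (KP3).
    rw [← h2, mul_assoc, h (KP.gen R Λ (.path L)), h (KP.gen R Λ (.ghost M)), mul_assoc,
      ← mul_assoc, F.ghost_mul_ne L M (hl.trans hm.symm) fun h => hne (congrArg Subtype.val h),
      zero_mul]

end Commutative

/-! ### Disjoint unions of copies of `ℕ^k` -/

section Union

variable {k : ℕ}

theorem deg_eqToHom (Λ : KGraph.{u, v} k) {a b : Λ.Obj} (h : a = b) : Λ.deg (eqToHom h) = 0 := by
  subst h
  exact Λ.deg_id a

theorem eq_of_natUnion_hom {ι : Type w} [Countable ι]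
    {X Y : (disjointUnion fun _ : ι => natGraph k).Obj} (f : X ⟶ Y) : X = Y := by
  obtain ⟨f⟩ := f
  rfl

theorem natUnion_hom_ext {ι : Type w} [Countable ι]
    {X Y : (disjointUnion fun _ : ι => natGraph k).Obj} (f g : X ⟶ Y)
    (h : (disjointUnion fun _ : ι => natGraph k).deg f =
      (disjointUnion fun _ : ι => natGraph k).deg g) : f = g := by
  obtain ⟨f⟩ := f
  obtain ⟨g⟩ := g
  exact congrArg Sigma.SigmaHom.mk h

/-- The vertex of the component `i` of a disjoint union of copies of `ℕ^k`. -/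
def natUnionVertex {ι : Type w} [Countable ι] (i : ι) :
    (disjointUnion fun _ : ι => natGraph k).Obj :=
  ⟨i, SingleObj.star (Multiplicative (Fin k → ℕ))⟩

/-- The path of degree `n` in the component `i` of a disjoint union of copies of `ℕ^k`. -/
def natUnionPath {ι : Type w} [Countable ι] (i : ι) (n : Fin k → ℕ) :
    natUnionVertex (k := k) i ⟶ natUnionVertex i :=
  Sigma.SigmaHom.mk (Multiplicative.ofAdd n)

variable {Λ : KGraph.{u, v} k}

theorem hom_ext_of_injOn_range (h : ∀ n : Fin k → ℕ, Set.InjOn Λ.r {l : Λ.Path | Λ.d l = n})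
    {a b : Λ.Obj} (f g : a ⟶ b) (hd : Λ.deg f = Λ.deg g) : f = g :=
  Arrow.mk_injective _ _ (h (Λ.deg g) (show Λ.d (Arrow.mk f) = _ from hd) rfl rfl)

theorem exists_loop (hΛ : Λ.NoSources) (h : ∀ l : Λ.Path, Λ.r l = Λ.s l) (a : Λ.Obj)
    (n : Fin k → ℕ) : ∃ f : a ⟶ a, Λ.deg f = n := by
  obtain ⟨⟨b, c, f⟩, hr, hd⟩ := hΛ a n
  have hs := h ⟨b, c, f⟩
  obtain rfl : c = a := hr
  obtain rfl : c = b := hs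
  exact ⟨f, hd⟩

/-- Functors between `k`-graphs agree if they agree on vertices, preserve degrees, and parallel
paths of equal degree in the codomain coincide. -/
theorem functor_ext_of_deg {Γ : KGraph.{w, z} k}
    (hΓ : ∀ {a b : Γ.Obj} (f g : a ⟶ b), Γ.deg f = Γ.deg g → f = g) {F G : Λ.Obj ⥤ Γ.Obj}
    (hobj : ∀ a, F.obj a = G.obj a)
    (hdeg : ∀ {a b : Λ.Obj} (f : a ⟶ b), Γ.deg (F.map f) = Γ.deg (G.map f)) : F = G :=
  CategoryTheory.Functor.ext hobj fun a b f => hΓ _ _ <| by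
    rw [Γ.deg_comp, Γ.deg_comp, deg_eqToHom, deg_eqToHom, hdeg, zero_add, add_zero]

/-- A `k`-graph all of whose paths are loops determined by their degree and vertex is a disjoint
union of copies of `ℕ^k`. -/
theorem nonempty_iso_natUnion (hΛ : Λ.NoSources) (h : ∀ l : Λ.Path, Λ.r l = Λ.s l)
    (h' : ∀ n : Fin k → ℕ, Set.InjOn Λ.r {l : Λ.Path | Λ.d l = n}) :
    Nonempty (Λ.Iso (disjointUnion fun _ : Λ.Obj => natGraph k)) := by
  choose p hp using exists_loop hΛ h
  let Γ := disjointUnion fun _ : Λ.Obj => natGraph k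
  -- Source and range agree only propositionally, hence the `eqToHom` corrections below. They have
  -- degree zero, and parallel paths are determined by degree, so every functor law becomes an
  -- identity of degrees.
  have hst : ∀ {a b : Λ.Obj} (f : a ⟶ b), a = b := fun f => (h (Arrow.mk f)).symm
  have hmap : ∀ {a b : Λ.Obj} (f : a ⟶ b), Γ.deg (natUnionPath a (Λ.deg f) ≫
      eqToHom (congrArg natUnionVertex (hst f))) = Λ.deg f := fun f => by
    rw [Γ.deg_comp, deg_eqToHom, zero_add]
    rfl
  have hmap' : ∀ {X Y : Γ.Obj} (f : X ⟶ Y), Λ.deg (p X.1 (Γ.deg f) ≫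
      eqToHom (congrArg Sigma.fst (eq_of_natUnion_hom f))) = Γ.deg f := fun f => by
    rw [Λ.deg_comp, deg_eqToHom, zero_add, hp]
  let F : Λ.Obj ⥤ Γ.Obj :=
    { obj := natUnionVertex
      map := fun {a b} f => natUnionPath a (Λ.deg f) ≫
        eqToHom (congrArg natUnionVertex (hst f))
      map_id := fun a => natUnion_hom_ext _ _ <| by rw [hmap, Λ.deg_id, Γ.deg_id]
      map_comp := fun f g => natUnion_hom_ext _ _ <| by
        rw [hmap, Γ.deg_comp, hmap, hmap, Λ.deg_comp] }
  let G : Γ.Obj ⥤ Λ.Obj :=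
    { obj := fun X => X.1
      map := fun {X Y} f => p X.1 (Γ.deg f) ≫
        eqToHom (congrArg Sigma.fst (eq_of_natUnion_hom f))
      map_id := fun a => hom_ext_of_injOn_range h' _ _ <| by rw [hmap', Λ.deg_id, Γ.deg_id]
      map_comp := fun f g => hom_ext_of_injOn_range h' _ _ <| by
        rw [hmap', Λ.deg_comp, hmap', hmap', Γ.deg_comp] }
  have hF : ∀ {a b : Λ.Obj} (f : a ⟶ b), Γ.deg (F.map f) = Λ.deg f := fun f => hmap f
  have hG : ∀ {X Y : Γ.Obj} (f : X ⟶ Y), Λ.deg (G.map f) = Γ.deg f := fun f => hmap' f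
  exact ⟨
    { toFunctor := F
      invFunctor := G
      left_inv := functor_ext_of_deg (hom_ext_of_injOn_range h') (fun _ => rfl) fun f =>
        (hG (F.map f)).trans (hF f)
      right_inv := functor_ext_of_deg natUnion_hom_ext (fun ⟨_, ⟨⟩⟩ => rfl) fun f =>
        (hF (G.map f)).trans (hG f)
      deg_map := hF }⟩

/-! ### Transporting the loop and injectivity conditions along isomorphisms -/

namespace Iso

variable {Γ : KGraph.{w, z} k}

theorem obj_injective (e : Λ.Iso Γ) : Function.Injective e.toFunctor.obj := fun a b h => by
  have := congrArg e.invFunctor.obj h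
  exact (Functor.congr_obj e.left_inv a).symm.trans (this.trans (Functor.congr_obj e.left_inv b))

theorem map_injective (e : Λ.Iso Γ) {a b : Λ.Obj} {f g : a ⟶ b} (h : e.toFunctor.map f = e.toFunctor.map g) :
    f = g := by
  have hf := Functor.congr_hom e.left_inv f
  have hg := Functor.congr_hom e.left_inv g
  rw [Functor.comp_map, h, ← Functor.comp_map, hg] at hf
  exact (cancel_mono _).1 ((cancel_epi _).1 hf.symm)

end Iso

theorem range_eq_source_of_iso {ι : Type w} [Countable ι]
    (e : Λ.Iso (disjointUnion fun _ : ι => natGraph k)) (l : Λ.Path) : Λ.r l = Λ.s l :=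
  e.obj_injective (eq_of_natUnion_hom (e.toFunctor.map l.hom)).symm

theorem injOn_range_of_iso {ι : Type w} [Countable ι]
    (e : Λ.Iso (disjointUnion fun _ : ι => natGraph k)) (n : Fin k → ℕ) :
    Set.InjOn Λ.r {l : Λ.Path | Λ.d l = n} := by
  rintro ⟨a, b, f⟩ hf ⟨a', b', g⟩ hg h
  obtain rfl : b = b' := h
  obtain rfl : b = a := range_eq_source_of_iso e ⟨a, b, f⟩
  obtain rfl : b = a' := range_eq_source_of_iso e ⟨a', b, g⟩
  refine congrArg Arrow.mk (e.map_injective (natUnion_hom_ext _ _ ?_))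
  exact (e.deg_map f).trans (hf.trans (hg.symm.trans (e.deg_map g).symm))

end Union

end KGraph

/-! ### Families of invertible elements indexed by a commutative monoid -/

/-- `S` is a homomorphism from `M` to the units of the corner at the idempotent `S 0`, and `T`
is its pointwise inverse. -/
structure IsInvertibleFamily {M : Type*} {A : Type*} [AddCommMonoid M] [NonUnitalRing A]
    (S T : M → A) : Prop where
  zero : T 0 = S 0
  mul : ∀ a b, S a * S b = S (a + b)
  inv_mul : ∀ a b, T a * T b = T (a + b)
  inv_mul_self : ∀ a, T a * S a = S 0
  mul_inv_self : ∀ a, S a * T a = S 0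

namespace IsInvertibleFamily

variable {M : Type*} {A : Type*} [AddCommMonoid M] [NonUnitalRing A] {S T : M → A}

/-- Cancelling a common factor of a fraction: `S c * T c` is the corner identity, which `T b`
absorbs. -/
theorem mul_inv_add (h : IsInvertibleFamily S T) (a b c : M) :
    S (a + c) * T (b + c) = S a * T b := by
  rw [← h.mul, add_comm b, ← h.inv_mul, mul_assoc, ← mul_assoc (S c), h.mul_inv_self, ← h.zero,
    h.inv_mul, zero_add]

/-- Both fractions are expanded to the common denominator `b + d`. -/
theorem mul_inv_eq (h : IsInvertibleFamily S T) {a b c d : M} (e : a + d = c + b) :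
    S a * T b = S c * T d := by
  rw [← h.mul_inv_add a b d, ← h.mul_inv_add c d b, e, add_comm b]

/-- Commutativity comes from that of `M`: in `T a * S (a + b) * T a` the factor `S a` can be split
off on either side and cancelled there. -/
theorem inv_mul_comm (h : IsInvertibleFamily S T) (a b : M) : T a * S b = S b * T a :=
  calc T a * S b = T a * S (a + b) * T a := by
        rw [add_comm, ← h.mul, mul_assoc, mul_assoc, h.mul_inv_self, h.mul, add_zero]
    _ = S b * T a := by
        rw [← h.mul, ← mul_assoc, h.inv_mul_self, h.mul, zero_add]

theorem mul_inv_mul_mul_inv (h : IsInvertibleFamily S T) (a b c d : M) :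
    S a * T b * (S c * T d) = S (a + c) * T (b + d) := by
  rw [← h.mul, ← h.inv_mul, mul_assoc, ← mul_assoc (T b), h.inv_mul_comm]
  simp only [mul_assoc]

end IsInvertibleFamily

namespace KGraph

section Laurent

variable {k : ℕ}

/-- A multidegree as an integer vector. -/
abbrev intDeg (n : Fin k → ℕ) : Fin k → ℤ := fun i => n i

theorem intDeg_add (m n : Fin k → ℕ) : intDeg (m + n) = intDeg m + intDeg n :=
  funext fun i => Nat.cast_add (m i) (n i)

/-! ### The Laurent polynomial family -/

variable (R : Type w) [CommRing R] {V : Type u}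

/-- The monomial `x^n` in the summand at `a`. -/
noncomputable def monomialAt (a : V) (n : Fin k → ℤ) : V →₀ LaurentRing R k :=
  Finsupp.single a (AddMonoidAlgebra.single n 1)

theorem monomialAt_mul (a : V) (m n : Fin k → ℤ) :
    monomialAt R a m * monomialAt R a n = monomialAt R a (m + n) := by
  simp [monomialAt, ← Finsupp.single_mul, AddMonoidAlgebra.single_mul_single]

theorem monomialAt_mul_of_ne {a b : V} (h : a ≠ b) (m n : Fin k → ℤ) :
    monomialAt R a m * monomialAt R b n = 0 := by
  classical
  ext c : 1
  rw [Finsupp.mul_apply, monomialAt, monomialAt, Finsupp.single_apply, Finsupp.single_apply]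
  split_ifs with h1 h2
  · exact absurd (h1.trans h2.symm) h
  all_goals simp

instance : IsScalarTower R (V →₀ LaurentRing R k) (V →₀ LaurentRing R k) :=
  ⟨fun c x y => by
    ext a : 1
    exact smul_mul_assoc c (x a) (y a)⟩

instance : SMulCommClass R (V →₀ LaurentRing R k) (V →₀ LaurentRing R k) :=
  ⟨fun c x y => by
    ext a : 1
    exact (mul_smul_comm c (x a) (y a)).symm⟩

variable {Λ : KGraph.{u, v} k}

theorem subsingleton_pathsTo (h : ∀ n : Fin k → ℕ, Set.InjOn Λ.r {l : Λ.Path | Λ.d l = n})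
    (x : Λ.Obj) (n : Fin k → ℕ) : Subsingleton (Λ.PathsTo x n) :=
  ⟨fun l m => Subtype.ext (h n l.2.2 m.2.2 (l.2.1.trans m.2.1.symm))⟩

/-- In a Kumjian-Pask family of a `k`-graph with a single path of each degree at each vertex, the
sums in (KP4) have a single summand. -/
theorem sum_pathsTo [Λ.RowFinite] {A : Type z} [AddCommMonoid A]
    (h : ∀ n : Fin k → ℕ, Set.InjOn Λ.r {l : Λ.Path | Λ.d l = n}) {x : Λ.Obj} {n : Fin k → ℕ}
    (f : Λ.PathsTo x n → A) (l : Λ.PathsTo x n) : ∑ m, f m = f l :=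
  haveI := subsingleton_pathsTo h x n
  Fintype.sum_subsingleton f l

/-- Since paths are loops, composable paths land in the same summand; since ranges separate paths of
equal degree, distinct ones land in different summands and multiply to zero. -/
theorem isKPFamily_monomialAt [Λ.RowFinite] (hΛ : Λ.NoSources)
    (h : ∀ l : Λ.Path, Λ.r l = Λ.s l)
    (h' : ∀ n : Fin k → ℕ, Set.InjOn Λ.r {l : Λ.Path | Λ.d l = n}) :
    Λ.IsKPFamily (fun x => monomialAt (k := k) R x 0)
      (fun l => monomialAt R (Λ.r l.1) (intDeg (Λ.d l.1)))
      (fun l => monomialAt R (Λ.r l.1) (-intDeg (Λ.d l.1))) where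
  idem x := by rw [monomialAt_mul, add_zero]
  orth x y hxy := monomialAt_mul_of_ne R hxy 0 0
  mul {a b c} f g hf hg := by
    obtain rfl : c = b := h (Arrow.mk f)
    refine (monomialAt_mul R c _ _).trans (congrArg (monomialAt R c) ?_)
    rw [← intDeg_add]
    exact congrArg intDeg (Λ.deg_comp g f).symm
  ghost_mul {a b c} f g hf hg := by
    obtain rfl : c = b := h (Arrow.mk f)
    refine (monomialAt_mul R c _ _).trans (congrArg (monomialAt R c) ?_)
    rw [← neg_add_rev, ← intDeg_add]
    exact congrArg (fun n => -intDeg n) (Λ.deg_comp g f).symm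
  range_mul l := by rw [monomialAt_mul, zero_add]
  mul_source l := by rw [← h, monomialAt_mul, add_zero]
  source_ghost l := by rw [← h, monomialAt_mul, zero_add]
  ghost_range l := by rw [monomialAt_mul, add_zero]
  ghost_mul_self l := by rw [← h, monomialAt_mul, neg_add_cancel]
  ghost_mul_ne l m hd hlm := monomialAt_mul_of_ne R
    (fun hr => hlm (Subtype.ext (h' _ hd rfl hr))) _ _
  sum x n hn := by
    obtain ⟨l⟩ := hΛ x n
    rw [sum_pathsTo h' _ l, monomialAt_mul, add_neg_cancel]
    rw [show Λ.r (Λ.toPos l hn).1 = x from l.2.1]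

/-! ### Kumjian-Pask families of disjoint unions of copies of `ℕ^k` -/

section Loops

variable {A : Type z} {P : Λ.Obj → A} {S T : Λ.PosPath → A}
  {p : ∀ (a : Λ.Obj) (_ : Fin k → ℕ), a ⟶ a}

open Classical in
/-- The value of `S` on the path `p a n`, or `P a` if `n = 0`. -/
noncomputable def loopValue (P : Λ.Obj → A) (S : Λ.PosPath → A)
    (hp : ∀ a n, Λ.deg (p a n) = n) (a : Λ.Obj) (n : Fin k → ℕ) : A :=
  if h : n = 0 then P a else S (Λ.pos (p a n) fun h' => h ((hp a n).symm.trans h'))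

theorem loopValue_zero (hp : ∀ a n, Λ.deg (p a n) = n) (a : Λ.Obj) :
    loopValue P S hp a 0 = P a := dif_pos rfl

theorem loopValue_of_ne (hp : ∀ a n, Λ.deg (p a n) = n) (a : Λ.Obj) {n : Fin k → ℕ}
    (hn : n ≠ 0) :
    loopValue P S hp a n = S (Λ.pos (p a n) fun h' => hn ((hp a n).symm.trans h')) := dif_neg hn

theorem loopValue_eq (hp : ∀ a n, Λ.deg (p a n) = n)
    (h : ∀ n : Fin k → ℕ, Set.InjOn Λ.r {l : Λ.Path | Λ.d l = n}) (l : Λ.PosPath) :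
    loopValue P S hp (Λ.r l.1) (Λ.d l.1) = S l := by
  rw [loopValue_of_ne hp _ l.2]
  exact congrArg S (Subtype.ext (h (Λ.d l.1) (hp _ _) rfl rfl))

variable [NonUnitalRing A]

/-- (KP3) makes the ghost a left inverse, and (KP4), with its single summand, a right inverse.
Degree zero is treated apart because there the generator is the vertex idempotent. -/
theorem IsKPFamily.isInvertibleFamily [Λ.RowFinite] (F : Λ.IsKPFamily P S T)
    (hp : ∀ a n, Λ.deg (p a n) = n)
    (h : ∀ n : Fin k → ℕ, Set.InjOn Λ.r {l : Λ.Path | Λ.d l = n}) (a : Λ.Obj) :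
    IsInvertibleFamily (loopValue P S hp a) (loopValue P T hp a) where
  zero := by rw [loopValue_zero, loopValue_zero]
  mul m n := by
    rcases eq_or_ne m 0 with rfl | hm <;> rcases eq_or_ne n 0 with rfl | hn
    · rw [loopValue_zero, add_zero, loopValue_zero, F.idem]
    · rw [loopValue_zero, zero_add, loopValue_of_ne hp a hn]
      exact F.range_mul (Λ.pos (p a n) fun h' => hn ((hp a n).symm.trans h'))
    · rw [loopValue_zero, add_zero, loopValue_of_ne hp a hm]
      exact F.mul_source _
    · rw [loopValue_of_ne hp a hm, loopValue_of_ne hp a hn, F.mul, ← loopValue_eq (P := P) (S := S) hp h]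
      exact congrArg _ ((Λ.deg_comp _ _).trans (congrArg₂ (· + ·) (hp a m) (hp a n)))
  inv_mul m n := by
    rcases eq_or_ne m 0 with rfl | hm <;> rcases eq_or_ne n 0 with rfl | hn
    · rw [loopValue_zero, add_zero, loopValue_zero, F.idem]
    · rw [loopValue_zero, zero_add, loopValue_of_ne hp a hn]
      exact F.source_ghost (Λ.pos (p a n) fun h' => hn ((hp a n).symm.trans h'))
    · rw [loopValue_zero, add_zero, loopValue_of_ne hp a hm]
      exact F.ghost_range _
    · rw [loopValue_of_ne hp a hm, loopValue_of_ne hp a hn, F.ghost_mul,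
        ← loopValue_eq (P := P) (S := T) hp h]
      exact congrArg _ ((Λ.deg_comp _ _).trans
        ((congrArg₂ (· + ·) (hp a n) (hp a m)).trans (add_comm n m)))
  inv_mul_self n := by
    rcases eq_or_ne n 0 with rfl | hn
    · rw [loopValue_zero, loopValue_zero, F.idem]
    · rw [loopValue_of_ne hp a hn, loopValue_of_ne hp a hn, loopValue_zero]
      exact F.ghost_mul_self _
  mul_inv_self n := by
    rcases eq_or_ne n 0 with rfl | hn
    · rw [loopValue_zero, loopValue_zero, F.idem]
    · rw [loopValue_of_ne hp a hn, loopValue_of_ne hp a hn, loopValue_zero, F.sum a n hn]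
      exact (sum_pathsTo h (fun l => S (Λ.toPos l hn) * T (Λ.toPos l hn))
        ⟨Arrow.mk (p a n), rfl, hp a n⟩).symm

/-- The image of the monomial `x^n` at the vertex `a`. -/
noncomputable def laurentValue (P : Λ.Obj → A) (S T : Λ.PosPath → A)
    (hp : ∀ a n, Λ.deg (p a n) = n) (a : Λ.Obj) (n : Fin k → ℤ) : A :=
  loopValue P S hp a (fun i => (n i).toNat) * loopValue P T hp a (fun i => (-n i).toNat)

theorem laurentValue_mul [Λ.RowFinite] (F : Λ.IsKPFamily P S T) (hp : ∀ a n, Λ.deg (p a n) = n)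
    (h : ∀ n : Fin k → ℕ, Set.InjOn Λ.r {l : Λ.Path | Λ.d l = n}) (a : Λ.Obj)
    (m n : Fin k → ℤ) :
    laurentValue P S T hp a m * laurentValue P S T hp a n = laurentValue P S T hp a (m + n) := by
  have H := F.isInvertibleFamily hp h a
  rw [laurentValue, laurentValue, H.mul_inv_mul_mul_inv]
  -- Positive and negative parts are not additive, but both fractions represent the same difference
  -- `m + n`.
  refine H.mul_inv_eq ?_
  ext i
  simp only [Pi.add_apply]
  omega

/-- Each value absorbs its own vertex idempotent, and the idempotents at `a` and `b` are orthogonal.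
-/
theorem laurentValue_mul_of_ne [Λ.RowFinite] (F : Λ.IsKPFamily P S T) (hp : ∀ a n, Λ.deg (p a n) = n)
    (h : ∀ n : Fin k → ℕ, Set.InjOn Λ.r {l : Λ.Path | Λ.d l = n}) {a b : Λ.Obj} (hab : a ≠ b)
    (m n : Fin k → ℤ) :
    laurentValue P S T hp a m * laurentValue P S T hp b n = 0 := by
  have Ha := F.isInvertibleFamily hp h a
  have Hb := F.isInvertibleFamily hp h b
  have h1 : laurentValue P S T hp a m * P a = laurentValue P S T hp a m := by
    rw [laurentValue, mul_assoc, ← loopValue_zero (P := P) (S := T) hp a, Ha.inv_mul, add_zero]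
  have h2 : P b * laurentValue P S T hp b n = laurentValue P S T hp b n := by
    rw [laurentValue, ← mul_assoc, ← loopValue_zero (P := P) (S := S) hp b, Hb.mul, zero_add]
  rw [← h1, ← h2, mul_assoc, ← mul_assoc (P a), F.orth a b hab, zero_mul, mul_zero]

theorem laurentValue_intDeg [Λ.RowFinite] (F : Λ.IsKPFamily P S T) (hp : ∀ a n, Λ.deg (p a n) = n)
    (h : ∀ n : Fin k → ℕ, Set.InjOn Λ.r {l : Λ.Path | Λ.d l = n}) (a : Λ.Obj)
    (n : Fin k → ℕ) : laurentValue P S T hp a (intDeg n) = loopValue P S hp a n := by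
  have H := F.isInvertibleFamily hp h a
  have e : (fun i => (-intDeg n i).toNat) = 0 := by
    ext i
    simp
  rw [laurentValue, e, H.zero, H.mul, add_zero]
  exact congrArg _ (funext fun i => Int.toNat_natCast _)

theorem laurentValue_neg_intDeg [Λ.RowFinite] (F : Λ.IsKPFamily P S T) (hp : ∀ a n, Λ.deg (p a n) = n)
    (h : ∀ n : Fin k → ℕ, Set.InjOn Λ.r {l : Λ.Path | Λ.d l = n}) (a : Λ.Obj)
    (n : Fin k → ℕ) : laurentValue P S T hp a (-intDeg n) = loopValue P T hp a n := by
  have H := F.isInvertibleFamily hp h a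
  have e : (fun i => ((-intDeg n) i).toNat) = 0 := by
    ext i
    simp
  rw [laurentValue, e, ← H.zero, H.inv_mul, zero_add]
  exact congrArg _ (funext fun i => by simp)

/-! ### The homomorphism from the sum of Laurent rings -/

variable {R} [Module R A]

/-- The linear map given by `laurentValue` on monomials. -/
noncomputable def laurentLinear (P : Λ.Obj → A) (S T : Λ.PosPath → A)
    (hp : ∀ a n, Λ.deg (p a n) = n) : (Λ.Obj →₀ LaurentRing R k) →ₗ[R] A :=
  Finsupp.lsum R fun a => Finsupp.linearCombination R (laurentValue P S T hp a) ∘ₗ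
    (AddMonoidAlgebra.coeffLinearEquiv R).toLinearMap

theorem laurentLinear_single (hp : ∀ a n, Λ.deg (p a n) = n) (a : Λ.Obj) (n : Fin k → ℤ)
    (c : R) : laurentLinear P S T hp (Finsupp.single a (AddMonoidAlgebra.single n c)) =
      c • laurentValue P S T hp a n := by
  simp [laurentLinear]

theorem laurentLinear_monomialAt (hp : ∀ a n, Λ.deg (p a n) = n) (a : Λ.Obj) (n : Fin k → ℤ) :
    laurentLinear P S T hp (monomialAt R a n) = laurentValue P S T hp a n :=
  (laurentLinear_single hp a n 1).trans (one_smul R _)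

theorem laurent_induction {V : Type u} {motive : (V →₀ LaurentRing R k) → Prop}
    (x : V →₀ LaurentRing R k) (zero : motive 0)
    (add : ∀ x y, motive x → motive y → motive (x + y))
    (smul : ∀ (c : R) (a : V) (n : Fin k → ℤ), motive (c • monomialAt R a n)) : motive x := by
  induction x using Finsupp.induction_linear with
  | zero => exact zero
  | add x y hx hy => exact add x y hx hy
  | single a f =>
    induction f using AddMonoidAlgebra.induction_linear with
    | zero => rwa [Finsupp.single_zero]
    | add f g hf hg =>
      rw [Finsupp.single_add]
      exact add _ _ hf hg
    | single n c => simpa [monomialAt] using smul c a n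

variable [IsScalarTower R A A] [SMulCommClass R A A]

theorem laurentLinear_mul [Λ.RowFinite] (F : Λ.IsKPFamily P S T) (hp : ∀ a n, Λ.deg (p a n) = n)
    (h : ∀ n : Fin k → ℕ, Set.InjOn Λ.r {l : Λ.Path | Λ.d l = n})
    (x y : Λ.Obj →₀ LaurentRing R k) :
    laurentLinear P S T hp (x * y) = laurentLinear P S T hp x * laurentLinear P S T hp y := by
  induction x using laurent_induction with
  | zero => simp
  | add x x' hx hx' => rw [add_mul, map_add, map_add, add_mul, hx, hx']
  | smul c a m =>
    induction y using laurent_induction with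
    | zero => simp
    | add y y' hy hy' => rw [mul_add, map_add, map_add, mul_add, hy, hy']
    | smul c' b n =>
      simp only [smul_mul_assoc, mul_smul_comm, map_smul, laurentLinear_monomialAt]
      rcases eq_or_ne a b with rfl | hab
      · rw [monomialAt_mul, laurentLinear_monomialAt, laurentValue_mul F hp h]
      · rw [monomialAt_mul_of_ne R hab, laurentValue_mul_of_ne F hp h hab, map_zero]

/-- The algebra homomorphism from the direct sum of Laurent polynomial rings determined by a
Kumjian-Pask family. -/
noncomputable def laurentHom [Λ.RowFinite] (F : Λ.IsKPFamily P S T) (hp : ∀ a n, Λ.deg (p a n) = n)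
    (h : ∀ n : Fin k → ℕ, Set.InjOn Λ.r {l : Λ.Path | Λ.d l = n}) :
    (Λ.Obj →₀ LaurentRing R k) →ₙₐ[R] A :=
  { toFun := laurentLinear P S T hp
    map_smul' := map_smul (laurentLinear P S T hp)
    map_zero' := map_zero (laurentLinear P S T hp)
    map_add' := map_add (laurentLinear P S T hp)
    map_mul' := laurentLinear_mul F hp h }

theorem laurentHom_monomialAt [Λ.RowFinite] (F : Λ.IsKPFamily P S T) (hp : ∀ a n, Λ.deg (p a n) = n)
    (h : ∀ n : Fin k → ℕ, Set.InjOn Λ.r {l : Λ.Path | Λ.d l = n}) (a : Λ.Obj)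
    (n : Fin k → ℤ) :
    laurentHom (R := R) F hp h (monomialAt R a n) = laurentValue P S T hp a n :=
  laurentLinear_monomialAt hp a n

end Loops

/-- The universal property gives `φ`, and the universal family itself gives `ψ` backwards. `ψ.comp
φ` is the identity by uniqueness of lifts; the other composite is checked on monomials. -/
theorem exists_bijective_kp_laurent [Λ.RowFinite] (hΛ : Λ.NoSources)
    (h : ∀ l : Λ.Path, Λ.r l = Λ.s l)
    (h' : ∀ n : Fin k → ℕ, Set.InjOn Λ.r {l : Λ.Path | Λ.d l = n}) :
    ∃ φ : Λ.KP R →ₙₐ[R] (Λ.Obj →₀ LaurentRing R k), Function.Bijective φ := by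
  choose p hp using exists_loop hΛ h
  have F := KP.isKPFamily R Λ
  obtain ⟨φ, ⟨hφ1, hφ2, hφ3⟩, -⟩ :=
    KP.existsUnique_lift (R := R) (isKPFamily_monomialAt R hΛ h h')
  let ψ := laurentHom (R := R) F hp h'
  have hψ : ∀ a n, ψ (monomialAt R a n) = laurentValue _ _ _ hp a n :=
    laurentHom_monomialAt F hp h'
  have hψ0 : ∀ x, ψ (monomialAt R x 0) = KP.gen R Λ (.vertex x) := fun x => by
    rw [hψ, ← show intDeg (0 : Fin k → ℕ) = 0 from rfl, laurentValue_intDeg F hp h',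
      loopValue_zero]
  have hψ1 : ∀ l : Λ.PosPath,
      ψ (monomialAt R (Λ.r l.1) (intDeg (Λ.d l.1))) = KP.gen R Λ (.path l) := fun l => by
    rw [hψ, laurentValue_intDeg F hp h', loopValue_eq hp h']
  have hψ2 : ∀ l : Λ.PosPath,
      ψ (monomialAt R (Λ.r l.1) (-intDeg (Λ.d l.1))) = KP.gen R Λ (.ghost l) := fun l => by
    rw [hψ, laurentValue_neg_intDeg F hp h', loopValue_eq hp h']
  have hleft : ψ.comp φ = NonUnitalAlgHom.id R (Λ.KP R) := by
    refine (KP.existsUnique_lift (R := R) F).unique ⟨?_, ?_, ?_⟩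
      ⟨fun _ => rfl, fun _ => rfl, fun _ => rfl⟩
    · intro x
      rw [NonUnitalAlgHom.comp_apply, hφ1, hψ0]
    · intro l
      rw [NonUnitalAlgHom.comp_apply, hφ2, hψ1]
    · intro l
      rw [NonUnitalAlgHom.comp_apply, hφ3, hψ2]
  have hloop : ∀ a n, φ (loopValue (fun x => KP.gen R Λ (.vertex x))
      (fun l => KP.gen R Λ (.path l)) hp a n) = monomialAt R a (intDeg n) := fun a n => by
    rcases eq_or_ne n 0 with rfl | hn
    · rw [loopValue_zero, hφ1]
      rfl
    · rw [loopValue_of_ne hp a hn, hφ2]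
      exact congrArg (fun m => monomialAt R a (intDeg m)) (hp a n)
  have hloop' : ∀ a n, φ (loopValue (fun x => KP.gen R Λ (.vertex x))
      (fun l => KP.gen R Λ (.ghost l)) hp a n) = monomialAt R a (-intDeg n) := fun a n => by
    rcases eq_or_ne n 0 with rfl | hn
    · rw [loopValue_zero, hφ1, show -intDeg (0 : Fin k → ℕ) = 0 from neg_zero]
    · rw [loopValue_of_ne hp a hn, hφ3]
      exact congrArg (fun m => monomialAt R a (-intDeg m)) (hp a n)
  refine ⟨φ, Function.LeftInverse.injective (g := ψ) (DFunLike.congr_fun hleft),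
    Function.RightInverse.surjective (g := ψ) fun x => ?_⟩
  induction x using laurent_induction with
  | zero => rw [map_zero, map_zero]
  | add x y hx hy => rw [map_add, map_add, hx, hy]
  | smul c a n =>
    rw [map_smul, map_smul, hψ, laurentValue, map_mul, hloop, hloop', monomialAt_mul]
    -- What remains is $n^+ - n^- = n$ in each coordinate.
    congr 2
    ext i
    simp only [intDeg, Pi.add_apply, Pi.neg_apply]
    omega

end Laurent

end KGraph

/-- In the last item, `Λ.Obj →₀ LaurentRing R k`, with coordinatewise operations, is the direct sum
over the vertices; the isomorphism is one of (possibly non-unital) `R`-algebras. -/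
theorem mainTheorem2 {k : ℕ} (Λ : KGraph.{u, v} k) [Λ.RowFinite] (hΛ : Λ.NoSources)
    (R : Type w) [CommRing R] [Nontrivial R] :
    List.TFAE [
      ∀ a b : Λ.KP R, a * b = b * a,
      (∀ l : Λ.Path, Λ.r l = Λ.s l) ∧
        ∀ n : Fin k → ℕ, Set.InjOn Λ.r {l : Λ.Path | Λ.d l = n},
      Nonempty (Λ.Iso (KGraph.disjointUnion fun _ : Λ.Obj => KGraph.natGraph k)),
      ∃ φ : Λ.KP R →ₙₐ[R] (Λ.Obj →₀ LaurentRing R k), Function.Bijective φ] := by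
  tfae_have 1 → 2 := fun h =>
    ⟨KGraph.range_eq_source_of_commutative R hΛ h, KGraph.injOn_range_of_commutative R hΛ h⟩
  tfae_have 2 → 3 := fun h => KGraph.nonempty_iso_natUnion hΛ h.1 h.2
  tfae_have 3 → 2 := fun ⟨e⟩ =>
    ⟨KGraph.range_eq_source_of_iso e, KGraph.injOn_range_of_iso e⟩
  tfae_have 2 → 4 := fun h => KGraph.exists_bijective_kp_laurent R hΛ h.1 h.2
  tfae_have 4 → 1 := fun ⟨φ, hφ⟩ a b => hφ.1 (by rw [map_mul, map_mul, mul_comm])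
  tfae_finish
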